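/- For a commutative ring $A$ with identity and a positive integer $m$, the $m$-th Pythagoras number $p_m(A)$ is the least positive integer $\ell$ such that every finite sum of $m$-th powers of elements of $A$ is a sum of $\ell$ $m$-th powers of elements of $A$; if no such $\ell$ exists, $p_m(A)=\infty$. Let $R$ be a (Noetherian) regular local ring of Krull dimension at least $3$ whose residue field is formally real. Then $p_{2s}(R)=\infty$ for every integer $s\ge 1$. -/

import Mathlib

/-- `a` is a sum of exactly `l` `s`-th powers of elements of `A`
(the elements are allowed to be zero or to repeat). -/
def IsSumOfPowers {A : Type*} [CommRing A] (s l : ℕ) (a : A) : Prop :=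
  ∃ f : Fin l → A, a = ∑ i, f i ^ s

/-- The `s`-th Pythagoras number of `A`: the least positive integer `l` such that every
(finite) sum of `s`-th powers of elements of `A` is a sum of `l` `s`-th powers of elements of `A`.
It is `⊤` (that is, infinity) when no such `l` exists, since `sInf ∅ = ⊤` in `ℕ∞`. -/
noncomputable def pythagorasNumber (s : ℕ) (A : Type*) [CommRing A] : ℕ∞ :=
  sInf {p : ℕ∞ | ∃ l : ℕ, p = (l : ℕ∞) ∧ 0 < l ∧
    ∀ a : A, (∃ m : ℕ, IsSumOfPowers s m a) → IsSumOfPowers s l a}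

/-!
Let `x` be a regular system of parameters of `R`, let `k` be the residue field and let `l ≥ 1`. The
aim is a sum of `l + 1` powers with exponent `2 s` in `R` which is not a sum of `l` such powers.

*Reduction to forms over `k`.* The initial forms of elements of `R` live in the polynomial ring
over `k`, because `x` is quasi-regular (`map_residue_eq_zero_of_eval_mem`). As `k` is formally real,
leading forms of even powers do not cancel. Hence if `∑ j, f j ^ (2 s) = ∑ i, H i (x) ^ (2 s)`
with forms `H i` of degree `D`, all `f j` have order at least `D`, and their parts of degree `D`
satisfy the same identity over `k` (`exists_isHomogeneous_sum_pow_eq`). Since `dim R ≥ 3`, the `H i`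
can be taken to be ternary forms, and the other variables can then be set to zero.

*Ternary forms.* Take `l + 1` lines in the plane, no three of them concurrent, here tangents to a
conic, and let `H i` be the product of all the lines except the `i`-th. All `H i` vanish at all the
points where two of the lines meet, so, again because `k` is formally real, the same is true of
forms `F j` of degree `l` with `∑ j, F j ^ (2 s) = ∑ i, H i ^ (2 s)`. The restriction of `F j` to
the line `a` then has `l` prescribed zeros, so it is a scalar `c a j` times a fixed polynomial. At
the point where the lines `a` and `b` meet, the linear part of `F j` is determined by `c a j` and
`c b j`, and comparison of the parts of degree `2 s` of the two sides shows that
`∑ j, c a j ^ (2 s - 1) * c b j` vanishes for `a ≠ b` and not for `a = b`. By comparison of ranks,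
there are at least `l + 1` of the `F j` (`card_le_of_sum_pow_eq_sum_tangentProd_pow`).
-/

/-! ### Sums of even powers in formally real rings -/

theorem IsFormallyReal.eq_zero_of_sum_sq_eq_zero {A κ : Type*} [CommRing A] [IsFormallyReal A]
    [Fintype κ] {f : κ → A} (h : ∑ j, f j ^ 2 = 0) (j : κ) : f j = 0 := by
  classical
  rw [← Finset.add_sum_erase _ _ (Finset.mem_univ j)] at h
  exact eq_zero_of_pow_eq_zero
    (eq_zero_of_add_right (by rw [pow_two]; exact IsSumSq.mul_self _) (IsSumSq.sum_sq _ _) h)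

theorem IsFormallyReal.eq_zero_of_sum_even_pow_eq_zero {A κ : Type*} [CommRing A]
    [IsFormallyReal A] [Fintype κ] {s : ℕ} {f : κ → A}
    (h : ∑ j, f j ^ (2 * s) = 0) (j : κ) : f j = 0 :=
  eq_zero_of_pow_eq_zero (eq_zero_of_sum_sq_eq_zero (f := fun j => f j ^ s)
    (by simpa [pow_mul'] using h) j)

theorem IsFormallyReal.charZero (k : Type*) [Field k] [IsFormallyReal k] : CharZero k := by
  refine charZero_of_inj_zero fun n hn => ?_
  by_contra h0
  have h : ∑ _j : Fin n, (1 : k) ^ 2 = 0 := by simp [hn]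
  exact one_ne_zero (eq_zero_of_sum_sq_eq_zero h ⟨0, Nat.pos_of_ne_zero h0⟩)

namespace MvPolynomial

/-- Even powers of polynomials over a formally real field do not cancel, because their values
do not. -/
theorem eq_zero_of_sum_even_pow_eq_zero {σ κ k : Type*} [Field k] [IsFormallyReal k] [Fintype κ]
    {s : ℕ} {F : κ → MvPolynomial σ k} (h : ∑ j, F j ^ (2 * s) = 0)
    (j : κ) : F j = 0 := by
  have := IsFormallyReal.charZero k
  refine MvPolynomial.funext fun v => ?_
  have hv := congrArg (eval v) h
  simp only [map_sum, map_pow, map_zero] at hv ⊢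
  exact IsFormallyReal.eq_zero_of_sum_even_pow_eq_zero hv j

end MvPolynomial

/-! ### Directional derivatives of multivariate polynomials -/

namespace MvPolynomial

/-- The derivative at `p` in the direction `v` of the polynomial `F`. -/
noncomputable def dirDeriv {σ k : Type*} [Fintype σ] [CommRing k] (p v : σ → k)
    (F : MvPolynomial σ k) : k :=
  ∑ i, eval p (pderiv i F) * v i

theorem eval_aeval_polynomial {σ k : Type*} [CommRing k] (q : σ → Polynomial k) (t : k)
    (F : MvPolynomial σ k) : (aeval q F).eval t = eval (fun i => (q i).eval t) F := by
  have : ((Polynomial.aeval t).comp (aeval q) : MvPolynomial σ k →ₐ[k] k) =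
      aeval (fun i => (q i).eval t) := by
    ext i; simp
  simpa [Polynomial.coe_aeval_eq_eval, MvPolynomial.coe_aeval_eq_eval] using
    DFunLike.congr_fun this F

section DirDeriv

variable {σ k : Type*} [Fintype σ] [CommRing k]

theorem dirDeriv_add_smul (p u w : σ → k) (S : k) (F : MvPolynomial σ k) :
    dirDeriv p (u + S • w) F = dirDeriv p u F + dirDeriv p w F * S := by
  simp only [dirDeriv, Pi.add_apply, Pi.smul_apply, smul_eq_mul, Finset.sum_mul,
    ← Finset.sum_add_distrib]
  exact Finset.sum_congr rfl fun i _ => by ring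

theorem derivative_aeval (q : σ → Polynomial k) (F : MvPolynomial σ k) :
    Polynomial.derivative (aeval q F) =
      ∑ i, aeval q (pderiv i F) * Polynomial.derivative (q i) := by
  classical
  induction F using MvPolynomial.induction_on with
  | C a => simp
  | add f g hf hg => simp [hf, hg, add_mul, Finset.sum_add_distrib]
  | mul_X f j hf =>
    simp only [map_mul, aeval_X, Polynomial.derivative_mul, hf, Derivation.leibniz, pderiv_X,
      smul_eq_mul, map_add, add_mul, Finset.sum_add_distrib, Finset.sum_mul]
    have hX : ∑ i, aeval q f * aeval q (Pi.single (M := fun _ => MvPolynomial σ k) i 1 j) *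
        Polynomial.derivative (q i) = aeval q f * Polynomial.derivative (q j) := by
      rw [Finset.sum_eq_single j (fun i _ hi => by simp [Pi.single_eq_of_ne hi.symm]) (by simp)]
      simp
    rw [hX, add_comm]
    exact congrArg _ (Finset.sum_congr rfl fun i _ => by
      rw [mul_right_comm, mul_comm (aeval q (pderiv i f))])

/-- Along a polynomial curve, the derivative of `F` is the derivative in the tangent direction. -/
theorem eval_derivative_aeval (q : σ → Polynomial k) (t : k) (F : MvPolynomial σ k) :
    (Polynomial.derivative (aeval q F)).eval t =
      dirDeriv (fun i => (q i).eval t) (fun i => (Polynomial.derivative (q i)).eval t) F := by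
  simp [derivative_aeval, dirDeriv, Polynomial.eval_finsetSum, eval_aeval_polynomial]

/-- If all `F j` vanish at `p`, the degree `n` part at `p` of `∑ j, F j ^ n` is the sum of the
`n`-th powers of the linear parts of the `F j`. -/
theorem sum_dirDeriv_pow {κ : Type*} [Fintype κ] (n : ℕ) (p v : σ → k)
    (F : κ → MvPolynomial σ k) (hF : ∀ j, eval p (F j) = 0) :
    ∑ j, dirDeriv p v (F j) ^ n =
      (aeval (fun i => Polynomial.C (p i) + Polynomial.C (v i) * Polynomial.X)
        (∑ j, F j ^ n)).coeff n := by
  rw [map_sum, Polynomial.finsetSum_coeff]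
  refine Finset.sum_congr rfl fun j _ => ?_
  set q : σ → Polynomial k := fun i => Polynomial.C (p i) + Polynomial.C (v i) * Polynomial.X
  have h0 : (aeval q (F j)).coeff 0 = 0 := by
    rw [Polynomial.coeff_zero_eq_eval_zero, eval_aeval_polynomial]
    simpa [q] using hF j
  obtain ⟨g, hg⟩ := Polynomial.X_dvd_iff.mpr h0
  have h1 : dirDeriv p v (F j) = g.coeff 0 := by
    have := eval_derivative_aeval q 0 (F j)
    rw [hg] at this
    simpa [q, Polynomial.coeff_zero_eq_eval_zero] using this.symm
  rw [map_pow, hg, mul_pow, h1]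
  simpa [Polynomial.coeff_zero_eq_eval_zero] using (Polynomial.coeff_X_pow_mul (g ^ n) n 0).symm

end DirDeriv

/-- Comparing the coefficients of `S` in an identity between sums of `n`-th powers of linear
forms. -/
theorem sum_pow_pred_mul_eq {κ ι k : Type*} [Fintype κ] [Fintype ι] [Field k] [CharZero k]
    {n : ℕ} (hn : n ≠ 0) (a b : κ → k) (c d : ι → k)
    (h : ∀ S : k, ∑ j, (a j + b j * S) ^ n = ∑ i, (c i + d i * S) ^ n) :
    ∑ j, a j ^ (n - 1) * b j = ∑ i, c i ^ (n - 1) * d i := by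
  have key : ∑ j, (Polynomial.C (a j) + Polynomial.C (b j) * Polynomial.X) ^ n =
      ∑ i, (Polynomial.C (c i) + Polynomial.C (d i) * Polynomial.X) ^ n :=
    Polynomial.funext fun S => by simpa [Polynomial.eval_finsetSum] using h S
  have := congrArg (fun P => (Polynomial.derivative P).eval 0) key
  simpa [Polynomial.eval_finsetSum, Polynomial.derivative_sum, Polynomial.derivative_pow,
    mul_assoc, ← Finset.mul_sum, hn] using this

theorem _root_.Lagrange.coeff_nodal_card {ι k : Type*} [CommRing k] [Nontrivial k] (s : Finset ι)
    (v : ι → k) : (Lagrange.nodal s v).coeff s.card = 1 := by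
  simpa [Lagrange.natDegree_nodal] using (Lagrange.nodal_monic (s := s) (v := v)).coeff_natDegree

/-! ### Tangents to a conic and the lower bound for ternary forms -/

/-- The linear form in three variables whose zero locus is, in the chart where the last coordinate
is `1`, the line `y = a x - a ^ 2`. In characteristic zero these lines are tangents to the conic
`4 y = x ^ 2`; those with parameters `a ≠ b` meet in the point `(a + b, a b)`, and no three of them
are concurrent. -/
noncomputable def conicTangent {A : Type*} [CommRing A] (a : A) : MvPolynomial (Fin 3) A :=
  X 1 - C a * X 0 + C (a ^ 2) * X 2

/-- The product of all the lines of a family of tangents to a conic except the one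
with index `i`. -/
noncomputable def tangentProd {A ι : Type*} [CommRing A] [Fintype ι] [DecidableEq ι] (z : ι → A)
    (i : ι) : MvPolynomial (Fin 3) A :=
  ∏ c ∈ Finset.univ.erase i, conicTangent (z c)

theorem isHomogeneous_conicTangent {A : Type*} [CommRing A] (a : A) :
    (conicTangent a).IsHomogeneous 1 :=
  ((isHomogeneous_X _ _).sub (isHomogeneous_C_mul_X _ _)).add (isHomogeneous_C_mul_X _ _)

theorem map_conicTangent {A B : Type*} [CommRing A] [CommRing B] (φ : A →+* B) (a : A) :
    map φ (conicTangent a) = conicTangent (φ a) := by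
  simp [conicTangent]

section TangentProd

variable {ι : Type*} [Fintype ι] [DecidableEq ι]

theorem isHomogeneous_tangentProd {A : Type*} [CommRing A] (z : ι → A) (i : ι) :
    (tangentProd z i).IsHomogeneous (Fintype.card ι - 1) := by
  have := IsHomogeneous.prod (Finset.univ.erase i) (fun c => conicTangent (z c)) (fun _ => 1)
    fun c _ => isHomogeneous_conicTangent (z c)
  simpa [tangentProd] using this

theorem map_tangentProd {A B : Type*} [CommRing A] [CommRing B] (φ : A →+* B) (z : ι → A) (i : ι) :
    map φ (tangentProd z i) = tangentProd (φ ∘ z) i := by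
  simp [tangentProd, map_prod, map_conicTangent]

variable {k : Type*} [Field k]

/-- A parametrization, in homogeneous coordinates, of the zero locus of `conicTangent a`. -/
noncomputable def tangentParam (a : k) : Fin 3 → Polynomial k :=
  ![Polynomial.X, Polynomial.C a * Polynomial.X - Polynomial.C (a ^ 2), 1]

theorem aeval_tangentParam_conicTangent (a b : k) :
    aeval (tangentParam a) (conicTangent b) =
      Polynomial.C (a - b) * (Polynomial.X - Polynomial.C (a + b)) := by
  simp only [tangentParam, conicTangent, map_add, map_sub, map_mul, aeval_X, aeval_C,
    ← Polynomial.C_eq_algebraMap, map_pow]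
  simp
  ring

/-- The intersection point of the tangents with parameters `a` and `b`. -/
def tangentPoint (a b : k) : Fin 3 → k := ![a + b, a * b, 1]

theorem tangentPoint_comm (a b : k) : tangentPoint a b = tangentPoint b a := by
  simp [tangentPoint, add_comm, mul_comm]

theorem eval_tangentParam (a b : k) :
    (fun i => (tangentParam a i).eval (a + b)) = tangentPoint a b := by
  funext i
  fin_cases i
  · simp [tangentParam, tangentPoint]
  · simp [tangentParam, tangentPoint]; ring
  · simp [tangentParam, tangentPoint]

theorem eval_derivative_tangentParam (a t : k) :
    (fun i => (Polynomial.derivative (tangentParam a i)).eval t) = ![1, a, 0] := by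
  funext i
  fin_cases i <;> simp [tangentParam, Polynomial.derivative_pow]

theorem eval_tangentPoint_conicTangent_left (a b : k) :
    eval (tangentPoint a b) (conicTangent a) = 0 := by
  simp [tangentPoint, conicTangent]; ring

theorem eval_tangentPoint_tangentProd (z : ι → k) {a b : ι} (hab : a ≠ b) (i : ι) :
    eval (tangentPoint (z a) (z b)) (tangentProd z i) = 0 := by
  rw [tangentProd, map_prod]
  by_cases hi : i = a
  · refine Finset.prod_eq_zero (i := b) (by simp [hi, hab.symm]) ?_
    rw [tangentPoint_comm, eval_tangentPoint_conicTangent_left]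
  · exact Finset.prod_eq_zero (i := a) (by simp [Ne.symm hi])
      (eval_tangentPoint_conicTangent_left _ _)

/-- For a form of degree one less than the number of lines, vanishing at all the points where two
of the lines meet: its restriction to the line `a` is determined up to a scalar, and this is the
scalar. -/
noncomputable def tangentCoeff (z : ι → k) (a : ι) (F : MvPolynomial (Fin 3) k) : k :=
  (aeval (tangentParam (z a)) F).coeff (Fintype.card ι - 1)

theorem aeval_tangentParam_eq (z : ι → k) (hz : Function.Injective z) (a : ι)
    (F : MvPolynomial (Fin 3) k) (hF : F.IsHomogeneous (Fintype.card ι - 1))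
    (h0 : ∀ b, a ≠ b → eval (tangentPoint (z a) (z b)) F = 0) :
    aeval (tangentParam (z a)) F = Polynomial.C (tangentCoeff z a F) *
      Lagrange.nodal (Finset.univ.erase a) (fun b => z a + z b) := by
  have hcard : (Finset.univ.erase a).card = Fintype.card ι - 1 := by simp
  have hdeg : (aeval (tangentParam (z a)) F).natDegree ≤ Fintype.card ι - 1 := by
    have := aeval_natDegree_le (n := 1) F hF.totalDegree_le (tangentParam (z a)) (by
      intro i
      fin_cases i
      · simp [tangentParam]
      · simp only [tangentParam, Fin.mk_one, Matrix.cons_val_one, Matrix.cons_val_zero]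
        compute_degree
      · simp [tangentParam])
    simpa using this
  have hnod : (Polynomial.C (tangentCoeff z a F) *
      Lagrange.nodal (Finset.univ.erase a) (fun b => z a + z b)).natDegree ≤
      Fintype.card ι - 1 :=
    (Polynomial.natDegree_C_mul_le _ _).trans (by rw [Lagrange.natDegree_nodal, hcard])
  refine Polynomial.eq_of_degree_sub_lt_of_eval_index_eq (s := Finset.univ.erase a)
    (v := fun b => z a + z b) (fun b _ c _ h => hz (by simpa using h)) ?_ ?_
  · rw [hcard, Polynomial.degree_lt_iff_coeff_zero]
    intro m hm
    rcases hm.eq_or_lt with rfl | hm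
    · have h1 := hcard ▸ Lagrange.coeff_nodal_card (Finset.univ.erase a) (fun b => z a + z b)
      rw [Polynomial.coeff_sub, Polynomial.coeff_C_mul, h1, mul_one, tangentCoeff, sub_self]
    · rw [Polynomial.coeff_sub, Polynomial.coeff_eq_zero_of_natDegree_lt (hdeg.trans_lt hm),
        Polynomial.coeff_eq_zero_of_natDegree_lt (hnod.trans_lt hm), sub_self]
  · intro b hb
    rw [eval_aeval_polynomial, eval_tangentParam, h0 b (Finset.ne_of_mem_erase hb).symm,
      Polynomial.eval_mul, Lagrange.eval_nodal_at_node (v := fun b => z a + z b) hb, mul_zero]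

/-- The derivative along the line `a` at its intersection with the line `b` is the scalar
`tangentCoeff z a F` times a nonzero factor which does not depend on `F`. -/
theorem dirDeriv_tangentPoint (z : ι → k) (hz : Function.Injective z) {a b : ι} (hab : a ≠ b)
    (F : MvPolynomial (Fin 3) k) (hF : F.IsHomogeneous (Fintype.card ι - 1))
    (h0 : ∀ b, a ≠ b → eval (tangentPoint (z a) (z b)) F = 0) :
    dirDeriv (tangentPoint (z a) (z b)) ![1, z a, 0] F =
      tangentCoeff z a F * ∏ c ∈ (Finset.univ.erase a).erase b, (z b - z c) := by
  have h := eval_derivative_aeval (tangentParam (z a)) (z a + z b) F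
  rw [eval_tangentParam, eval_derivative_tangentParam, aeval_tangentParam_eq z hz a F hF h0,
    Polynomial.derivative_C_mul, Polynomial.eval_mul, Polynomial.eval_C,
    Lagrange.eval_nodal_derivative_eval_node_eq (v := fun b => z a + z b)
      (show b ∈ Finset.univ.erase a by simp [hab.symm]), Lagrange.eval_nodal] at h
  simpa using h.symm

theorem tangentCoeff_tangentProd_of_ne (z : ι → k) {a i : ι} (hai : a ≠ i) :
    tangentCoeff z a (tangentProd z i) = 0 := by
  rw [tangentCoeff, tangentProd, map_prod,
    Finset.prod_eq_zero (i := a) (by simp [hai]) (by simp [aeval_tangentParam_conicTangent])]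
  simp

theorem tangentCoeff_tangentProd_self (z : ι → k) (a : ι) :
    tangentCoeff z a (tangentProd z a) = ∏ b ∈ Finset.univ.erase a, (z a - z b) := by
  have hcard : (Finset.univ.erase a).card = Fintype.card ι - 1 := by simp
  have h1 := hcard ▸ Lagrange.coeff_nodal_card (Finset.univ.erase a) (fun b => z a + z b)
  rw [tangentCoeff, tangentProd, map_prod]
  simp_rw [aeval_tangentParam_conicTangent]
  rw [Finset.prod_mul_distrib, ← Lagrange.nodal_eq, ← map_prod, Polynomial.coeff_C_mul, h1, mul_one]

end TangentProd

/-- The sum of the `2 s`-th powers of the products of all but one of `N ≥ 2` tangents to a conic is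
not a sum of the `2 s`-th powers of fewer than `N` forms. At the point where the lines `a` and `b`
meet, the `F j` vanish and their linear parts are given by their coefficients `c a j` and `c b j`
along the two lines. Comparison of the parts of degree `2 s` gives
`∑ j, c a j ^ (2 s - 1) * c b j = 0`, while `∑ j, c a j ^ (2 s) ≠ 0`, so an invertible `N × N`
matrix factors through a space whose dimension is the number of the `F j`. -/
theorem card_le_of_sum_pow_eq_sum_tangentProd_pow {ι κ k : Type*} [Fintype ι] [DecidableEq ι]
    [Nontrivial ι] [Fintype κ] [Field k] [IsFormallyReal k] {s : ℕ} (hs : s ≠ 0) (z : ι → k)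
    (hz : Function.Injective z) (F : κ → MvPolynomial (Fin 3) k)
    (hF : ∀ j, (F j).IsHomogeneous (Fintype.card ι - 1))
    (h : ∑ j, F j ^ (2 * s) = ∑ i, tangentProd z i ^ (2 * s)) :
    Fintype.card ι ≤ Fintype.card κ := by
  have := IsFormallyReal.charZero k
  have hn : 2 * s ≠ 0 := by lia
  -- The `F j` vanish where all the products do.
  have h0 : ∀ j a b, a ≠ b → eval (tangentPoint (z a) (z b)) (F j) = 0 := by
    intro j a b hab
    refine IsFormallyReal.eq_zero_of_sum_even_pow_eq_zero (s := s)
      (f := fun j => eval (tangentPoint (z a) (z b)) (F j)) ?_ j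
    have := congrArg (eval (tangentPoint (z a) (z b))) h
    simpa [eval_tangentPoint_tangentProd z hab, hn] using this
  -- Compare leading forms at the point where the lines `a` and `b` meet.
  have hlin : ∀ a b, a ≠ b → ∀ S : k,
      ∑ j, (dirDeriv (tangentPoint (z a) (z b)) ![1, z a, 0] (F j) +
        dirDeriv (tangentPoint (z a) (z b)) ![1, z b, 0] (F j) * S) ^ (2 * s) =
      ∑ i, (dirDeriv (tangentPoint (z a) (z b)) ![1, z a, 0] (tangentProd z i) +
        dirDeriv (tangentPoint (z a) (z b)) ![1, z b, 0] (tangentProd z i) * S) ^ (2 * s) := by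
    intro a b hab S
    simp_rw [← dirDeriv_add_smul]
    rw [sum_dirDeriv_pow _ _ _ _ fun j => h0 j a b hab,
      sum_dirDeriv_pow _ _ _ _ fun i => eval_tangentPoint_tangentProd z hab i, h]
  have hδ : ∀ a b : ι, ∏ c ∈ (Finset.univ.erase a).erase b, (z b - z c) ≠ 0 := fun a b =>
    Finset.prod_ne_zero_iff.mpr fun c hc =>
      sub_ne_zero.mpr fun e => Finset.ne_of_mem_erase hc (hz e).symm
  have hdF : ∀ a b, a ≠ b → ∀ j, dirDeriv (tangentPoint (z a) (z b)) ![1, z a, 0] (F j) =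
      tangentCoeff z a (F j) * ∏ c ∈ (Finset.univ.erase a).erase b, (z b - z c) :=
    fun a b hab j => dirDeriv_tangentPoint z hz hab _ (hF j) (h0 j a)
  have hdH : ∀ a b, a ≠ b → ∀ i,
      dirDeriv (tangentPoint (z a) (z b)) ![1, z a, 0] (tangentProd z i) =
      tangentCoeff z a (tangentProd z i) * ∏ c ∈ (Finset.univ.erase a).erase b, (z b - z c) :=
    fun a b hab i => dirDeriv_tangentPoint z hz hab _ (isHomogeneous_tangentProd z i)
      fun b hb => eval_tangentPoint_tangentProd z hb i
  -- `γ a` is the value of `∑ j, c a j ^ (2 s)`.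
  let γ : ι → k := fun a => tangentCoeff z a (tangentProd z a) ^ (2 * s)
  have hγ : ∀ a, γ a ≠ 0 := fun a => pow_ne_zero _ (by
    rw [tangentCoeff_tangentProd_self]
    exact Finset.prod_ne_zero_iff.mpr fun c hc =>
      sub_ne_zero.mpr fun e => Finset.ne_of_mem_erase hc (hz e).symm)
  let A : Matrix ι κ k := fun a j => tangentCoeff z a (F j) ^ (2 * s - 1)
  let B : Matrix κ ι k := fun j a => tangentCoeff z a (F j)
  have hAB : A * B = Matrix.diagonal γ := by
    ext a b
    rw [Matrix.mul_apply]
    by_cases hab : a = b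
    · subst hab
      obtain ⟨b, hb⟩ := exists_ne a
      have := hlin a b hb.symm 0
      simp_rw [mul_zero, add_zero, hdF a b hb.symm, hdH a b hb.symm, mul_pow,
        ← Finset.sum_mul] at this
      have := mul_right_cancel₀ (pow_ne_zero _ (hδ a b)) this
      rw [Matrix.diagonal_apply_eq]
      simp only [A, B, γ, pow_sub_one_mul hn]
      rw [this]
      refine Finset.sum_eq_single a (fun i _ hi => ?_) (by simp)
      rw [tangentCoeff_tangentProd_of_ne z hi.symm, zero_pow hn]
    · have := sum_pow_pred_mul_eq hn _ _ _ _ (hlin a b hab)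
      simp_rw [hdF a b hab, hdH a b hab, tangentPoint_comm (z a) (z b),
        hdF b a (Ne.symm hab), hdH b a (Ne.symm hab)] at this
      rw [Matrix.diagonal_apply_ne _ hab]
      have hR : ∀ i, tangentCoeff z a (tangentProd z i) ^ (2 * s - 1) *
          tangentCoeff z b (tangentProd z i) = 0 := by
        intro i
        by_cases hi : a = i
        · subst hi
          rw [tangentCoeff_tangentProd_of_ne z (Ne.symm hab), mul_zero]
        · rw [tangentCoeff_tangentProd_of_ne z hi, zero_pow (by lia), zero_mul]
      simp_rw [mul_pow, mul_mul_mul_comm, ← Finset.sum_mul, hR, Finset.sum_const_zero,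
        zero_mul] at this
      exact (mul_eq_zero.mp this).resolve_right
        (mul_ne_zero (pow_ne_zero _ (hδ a b)) (hδ b a))
  have hrank : (A * B).rank = Fintype.card ι := by
    rw [hAB]
    refine Matrix.rank_of_isUnit _ ?_
    rw [Matrix.isUnit_iff_isUnit_det, Matrix.det_diagonal]
    exact (Finset.prod_ne_zero_iff.mpr fun a _ => hγ a).isUnit
  calc Fintype.card ι = (A * B).rank := hrank.symm
    _ ≤ A.rank := Matrix.rank_mul_le_left A B
    _ ≤ Fintype.card κ := Matrix.rank_le_card_width A

end MvPolynomial

/-! ### Values of forms and powers of ideals -/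

open IsLocalRing

namespace MvPolynomial

theorem IsHomogeneous.sum_support_eq {σ A : Type*} [CommSemiring A] {n : ℕ} {F : MvPolynomial σ A}
    (hF : F.IsHomogeneous n) {d : σ →₀ ℕ} (hd : d ∈ F.support) : ∑ i ∈ d.support, d i = n := by
  rw [← hF (mem_support_iff.mp hd)]
  simp [Finsupp.weight_apply, Finsupp.sum]

theorem IsHomogeneous.eval_mul {σ A : Type*} [CommRing A] {n : ℕ} {F : MvPolynomial σ A}
    (hF : F.IsHomogeneous n) (y : A) (w : σ → A) :
    eval (fun i => w i * y) F = eval w F * y ^ n := by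
  rw [eval_eq, eval_eq, Finset.sum_mul]
  refine Finset.sum_congr rfl fun d hd => ?_
  have hdeg := hF.sum_support_eq hd
  rw [← hdeg, ← Finset.prod_pow_eq_pow_sum]
  simp_rw [mul_pow, Finset.prod_mul_distrib, mul_assoc]

theorem sub_mem_of_forall_sub_mem {σ A : Type*} [CommRing A] (J : Ideal A) (F : MvPolynomial σ A)
    {x y : σ → A} (h : ∀ i, x i - y i ∈ J) : eval x F - eval y F ∈ J := by
  rw [← Ideal.Quotient.eq]
  have e : ∀ v : σ → A, Ideal.Quotient.mk J (eval v F) =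
      eval₂ (Ideal.Quotient.mk J) (fun i => Ideal.Quotient.mk J (v i)) F := fun v => by
    exact eval₂_comp_left _ (RingHom.id A) v F
  rw [e, e]
  congr 1
  funext i
  exact Ideal.Quotient.eq.mpr (h i)

theorem IsHomogeneous.killCompl {σ τ A : Type*} [CommRing A] {n : ℕ} {F : MvPolynomial τ A}
    (hF : F.IsHomogeneous n) {c : σ → τ} (hc : Function.Injective c) :
    (killCompl hc F).IsHomogeneous n := by
  classical
  rw [← one_mul n]
  unfold MvPolynomial.killCompl
  refine hF.aeval _ fun i => ?_
  split_ifs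
  · exact isHomogeneous_X _ _
  · exact isHomogeneous_zero _ _ _

end MvPolynomial

theorem Ideal.sup_pow_le_sup_pow {A : Type*} [CommSemiring A] (I J : Ideal A) (n : ℕ) :
    (I ⊔ J) ^ n ≤ I ⊔ J ^ n := by
  induction n with
  | zero => simp
  | succ n ih =>
    rw [pow_succ, pow_succ]
    refine (Ideal.mul_mono_left ih).trans ?_
    rw [Ideal.sup_mul, Ideal.mul_sup (J ^ n)]
    have h1 : I * (I ⊔ J) ≤ I := Ideal.mul_le_left
    have h2 : J ^ n * I ≤ I := Ideal.mul_le_right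
    exact sup_le (le_sup_of_le_left h1) (sup_le (le_sup_of_le_left h2) le_sup_right)

open MvPolynomial

/-! ### Leading forms in a regular local ring -/

/-- An ideal of a Noetherian ring is generated by a family indexed by its minimal number of
generators. -/
theorem exists_span_range_eq {R : Type*} [CommRing R] [IsNoetherianRing R] (I : Ideal R) :
    ∃ x : Fin (Submodule.spanFinrank I) → R, Ideal.span (Set.range x) = I := by
  have hfg : Submodule.FG I := IsNoetherian.noetherian I
  have : Finite (Submodule.generators I) := Submodule.FG.finite_generators hfg
  have hcard : Nat.card (Submodule.generators I) = Submodule.spanFinrank I :=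
    Submodule.FG.generators_ncard hfg
  let e := (Finite.equivFinOfCardEq hcard).symm
  refine ⟨fun i => e i, ?_⟩
  have hrange : Set.range (fun i => (e i : R)) = Submodule.generators I := by
    rw [← Function.comp_def, Set.range_comp, e.surjective.range_eq, Set.image_univ,
      Subtype.range_coe]
  rw [hrange]
  exact Submodule.span_generators I

section LocalRing

variable {R : Type*} [CommRing R]

theorem eval_mem_maximalIdeal_pow_succ [IsLocalRing R] {σ : Type*} {x : σ → R} {n : ℕ}
    {F : MvPolynomial σ R} (hF : F.IsHomogeneous n) (hx : ∀ i, x i ∈ maximalIdeal R)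
    (h0 : map (residue R) F = 0) : eval x F ∈ maximalIdeal R ^ (n + 1) := by
  rw [eval_eq]
  refine Ideal.sum_mem _ fun d hd => ?_
  have hdeg := hF.sum_support_eq hd
  have hmon : ∏ i ∈ d.support, x i ^ d i ∈ maximalIdeal R ^ n := by
    rw [← hdeg, ← Finset.prod_pow_eq_pow_sum]
    exact Ideal.prod_mem_prod (I := fun i => maximalIdeal R ^ d i) (x := fun i => x i ^ d i)
      fun i _ => Ideal.pow_mem_pow (hx i) _
  have hcoeff : coeff d F ∈ maximalIdeal R := by
    rw [← residue_eq_zero_iff, ← coeff_map, h0, coeff_zero]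
  rw [pow_succ']
  exact Ideal.mul_mem_mul hcoeff hmon

/-- A regular system of parameters is quasi-regular: a form over `R` whose value at `x` has higher
order than its degree reduces to zero over the residue field. Otherwise, after a change of
coordinates, a power of one generator of the maximal ideal would lie in the ideal generated by the
`d - 1` others, contradicting Krull's height theorem. -/
theorem map_residue_eq_zero_of_eval_mem [IsLocalRing R] [IsNoetherianRing R]
    [Infinite (ResidueField R)] {d : ℕ} (hd : ringKrullDim R = d) (hd0 : 0 < d) {x : Fin d → R}
    (hx : Ideal.span (Set.range x) = maximalIdeal R) {n : ℕ} {F : MvPolynomial (Fin d) R}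
    (hF : F.IsHomogeneous n) (h : eval x F ∈ maximalIdeal R ^ (n + 1)) :
    map (residue R) F = 0 := by
  by_contra hne
  classical
  set i₀ : Fin d := ⟨0, hd0⟩
  -- A point `v` over the residue field, off the hyperplane `X i₀ = 0`, where `F` does not vanish.
  have hprod : map (residue R) F * X i₀ ≠ 0 := mul_ne_zero hne (X_ne_zero i₀)
  obtain ⟨v, hv⟩ : ∃ v, eval v (map (residue R) F * X i₀) ≠ 0 := by
    by_contra! hall
    exact hprod (MvPolynomial.funext fun v => by simpa using hall v)
  rw [map_mul, eval_X] at hv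
  choose w hw using fun i => residue_surjective (R := R) (v i)
  have hunit : ∀ {r : R}, residue R r ≠ 0 → IsUnit r := fun hr => by
    by_contra hr'
    exact hr ((residue_eq_zero_iff _).mpr hr')
  have hwi : IsUnit (w i₀) := hunit (by rw [hw]; exact right_ne_zero_of_mul hv)
  have hFw : IsUnit (eval w F) := hunit (by
    have e : residue R (eval w F) = eval v (map (residue R) F) := by
      rw [eval_map, ← funext hw]
      exact eval₂_comp_left _ (RingHom.id R) w F
    rw [e]
    exact left_ne_zero_of_mul hv)
  obtain ⟨u, hu⟩ := hwi.exists_right_inv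
  set y := u * x i₀ with hy
  -- Modulo `J`, the vector `x` is `y • w` and the maximal ideal is generated by `y`.
  let S : Finset R := (Finset.univ.erase i₀).image fun i => x i - w i * y
  let J : Ideal R := Ideal.span S
  have hxJ : ∀ i, x i - w i * y ∈ J := by
    intro i
    by_cases hi : i = i₀
    · have : x i - w i * y = 0 := by rw [hi, hy]; linear_combination -(x i₀) * hu
      rw [this]; exact J.zero_mem
    · exact Ideal.subset_span (by
        simp only [S, Finset.coe_image]
        exact ⟨i, by simp [hi], rfl⟩)
  have hxm : ∀ i, x i ∈ maximalIdeal R := fun i => hx ▸ Ideal.subset_span ⟨i, rfl⟩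
  have hym : y ∈ maximalIdeal R := Ideal.mul_mem_left _ _ (hxm i₀)
  have hJm : J ≤ maximalIdeal R := by
    refine Ideal.span_le.mpr fun r hr => ?_
    simp only [S, Finset.coe_image] at hr
    obtain ⟨i, -, rfl⟩ := hr
    exact Ideal.sub_mem _ (hxm i) (Ideal.mul_mem_left _ _ hym)
  have hmJ : maximalIdeal R ≤ J ⊔ Ideal.span {y} := by
    rw [← hx, Ideal.span_le]
    rintro _ ⟨i, rfl⟩
    have : x i = (x i - w i * y) + w i * y := by ring
    rw [this]
    exact Ideal.add_mem _ (Ideal.mem_sup_left (hxJ i))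
      (Ideal.mem_sup_right (Ideal.mul_mem_left _ _ (Ideal.mem_span_singleton_self y)))
  -- Hence `y ^ n` is, up to a unit, a multiple of `y ^ (n + 1)`, so it lies in `J`.
  have hyn : y ^ n ∈ J := by
    have h1 : eval x F - eval w F * y ^ n ∈ J := by
      rw [← hF.eval_mul]
      exact sub_mem_of_forall_sub_mem J F hxJ
    have h2 : eval x F ∈ J ⊔ Ideal.span {y ^ (n + 1)} := by
      have h3 := Ideal.pow_right_mono hmJ (n + 1) h
      have h4 := J.sup_pow_le_sup_pow (Ideal.span {y}) (n + 1)
      rw [Ideal.span_singleton_pow] at h4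
      exact h4 h3
    obtain ⟨j, hj, b, hb, hjb⟩ := Submodule.mem_sup.mp h2
    obtain ⟨c, rfl⟩ := Ideal.mem_span_singleton'.mp hb
    have hun : IsUnit (eval w F - c * y) := hunit (by
      rw [map_sub (residue R), (residue_eq_zero_iff (c * y)).mpr (Ideal.mul_mem_left _ _ hym),
        sub_zero]
      exact fun h0 => (residue_eq_zero_iff _).mp h0 hFw)
    refine (Ideal.unit_mul_mem_iff_mem J hun).mp ?_
    have : (eval w F - c * y) * y ^ n = j - (eval x F - eval w F * y ^ n) := by
      rw [← hjb]; ring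
    rw [this]
    exact J.sub_mem hj h1
  -- So the maximal ideal is minimal over an ideal with `d - 1` generators.
  have hmin : maximalIdeal R ∈ J.minimalPrimes := by
    refine ⟨⟨inferInstance, hJm⟩, fun P hP _ => hmJ.trans (sup_le hP.2 ?_)⟩
    rw [Ideal.span_singleton_le_iff_mem]
    exact hP.1.mem_of_pow_mem n (hP.2 hyn)
  have hht := Ideal.height_le_spanRank_toENat_of_mem_minimalPrimes J _ hmin
  have hcard : J.spanRank.toENat ≤ (d - 1 : ℕ) := by
    have h1 : J.spanRank.toENat = J.spanFinrank := by
      rw [Submodule.fg_iff_spanRank_eq_spanFinrank.mpr (IsNoetherian.noetherian J), map_natCast]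
    rw [h1]
    refine Nat.cast_le.mpr ((Submodule.spanFinrank_span_le_ncard_of_finite S.finite_toSet).trans ?_)
    rw [Set.ncard_coe_finset]
    exact Finset.card_image_le.trans (by simp)
  have hm := maximalIdeal_height_eq_ringKrullDim (R := R)
  rw [hd] at hm
  have hm' : (maximalIdeal R).height = d := by exact_mod_cast hm
  have := hht.trans hcard
  rw [hm'] at this
  have : d ≤ d - 1 := by exact_mod_cast this
  lia

/-- In a regular local ring with formally real residue field, no cancellation of leading forms
occurs in sums of even powers: the `f j` have at least the expected order, and their leading forms
satisfy the same identity. -/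
theorem exists_isHomogeneous_sum_pow_eq [IsLocalRing R] [IsNoetherianRing R]
    [IsFormallyReal (ResidueField R)] {d : ℕ} (hd : ringKrullDim R = d) (hd0 : 0 < d)
    {x : Fin d → R} (hx : Ideal.span (Set.range x) = maximalIdeal R) {s : ℕ} (hs : s ≠ 0) {D : ℕ}
    {ι κ : Type*} [Fintype ι] [Fintype κ]
    (H : ι → MvPolynomial (Fin d) R) (hH : ∀ i, (H i).IsHomogeneous D) (f : κ → R)
    (hf : ∑ j, f j ^ (2 * s) = ∑ i, eval x (H i) ^ (2 * s)) :
    ∃ F : κ → MvPolynomial (Fin d) (ResidueField R), (∀ j, (F j).IsHomogeneous D) ∧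
      ∑ j, F j ^ (2 * s) = ∑ i, map (residue R) (H i) ^ (2 * s) := by
  have := IsFormallyReal.charZero (ResidueField R)
  have hxm : ∀ i, x i ∈ maximalIdeal R := fun i => hx ▸ Ideal.subset_span ⟨i, rfl⟩
  have hHm : ∀ i, eval x (H i) ∈ maximalIdeal R ^ D := fun i => by
    rw [← hx, Ideal.mem_span_pow_iff_exists_isHomogeneous]
    exact ⟨H i, hH i, rfl⟩
  have hlift : ∀ e, (∀ j, f j ∈ maximalIdeal R ^ e) →
      ∃ G : κ → MvPolynomial (Fin d) R, ∀ j, (G j).IsHomogeneous e ∧ eval x (G j) = f j := by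
    intro e he
    refine Classical.axiomOfChoice (r := fun j G => G.IsHomogeneous e ∧ eval x G = f j) fun j => ?_
    rw [← Ideal.mem_span_pow_iff_exists_isHomogeneous, hx]
    exact he j
  have horder : ∀ e ≤ D, ∀ j, f j ∈ maximalIdeal R ^ e := by
    intro e
    induction e with
    | zero => simp
    | succ e ih =>
      intro he
      -- The common value of the two sums has order at least `2 s D > 2 s e`, so the parts of
      -- degree `e` of the `f j` have `2 s`-th powers with sum zero.
      obtain ⟨G, hG⟩ := hlift e (ih (by lia))
      have h0 : map (residue R) (∑ j, G j ^ (2 * s)) = 0 := by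
        refine map_residue_eq_zero_of_eval_mem hd hd0 hx
          (IsHomogeneous.sum _ _ (e * (2 * s)) fun j _ => (hG j).1.pow _) ?_
        simp only [map_sum, map_pow, (hG _).2]
        rw [hf]
        refine Ideal.sum_mem _ fun i _ => ?_
        have hpow := Ideal.pow_mem_pow (hHm i) (2 * s)
        rw [← pow_mul] at hpow
        exact Ideal.pow_le_pow_right (by nlinarith [Nat.pos_of_ne_zero hs]) hpow
      simp only [map_sum, map_pow] at h0
      intro j
      rw [← (hG j).2]
      exact eval_mem_maximalIdeal_pow_succ (hG j).1 hxm (eq_zero_of_sum_even_pow_eq_zero h0 j)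
  obtain ⟨G, hG⟩ := hlift D (horder D le_rfl)
  refine ⟨fun j => map (residue R) (G j), fun j => (hG j).1.map _, ?_⟩
  have h0 : map (residue R) (∑ j, G j ^ (2 * s) - ∑ i, H i ^ (2 * s)) = 0 := by
    refine map_residue_eq_zero_of_eval_mem hd hd0 hx (n := D * (2 * s))
      ((IsHomogeneous.sum _ _ _ fun j _ => (hG j).1.pow _).sub
        (IsHomogeneous.sum _ _ _ fun i _ => (hH i).pow _)) ?_
    simp [(hG _).2, hf]
  simpa [sub_eq_zero] using h0

end LocalRing

/-! ### Pythagoras numbers -/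

theorem mainTheorem10 {R : Type*} [CommRing R] [IsRegularLocalRing R]
    (hdim : 3 ≤ ringKrullDim R)
    (hreal : IsFormallyReal (IsLocalRing.ResidueField R))
    (s : ℕ) (hs : 1 ≤ s) :
    pythagorasNumber (2 * s) R = ⊤ := by
  refine sInf_eq_top.mpr ?_
  rintro p ⟨l, -, hl, hsum⟩
  exfalso
  have hs0 : s ≠ 0 := by lia
  have := IsFormallyReal.charZero (ResidueField R)
  have hd := IsRegularLocalRing.spanFinrank_maximalIdeal (R := R)
  set d := (maximalIdeal R).spanFinrank
  have hd3 : 3 ≤ d := by rw [← hd] at hdim; exact_mod_cast hdim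
  obtain ⟨x, hx⟩ := exists_span_range_eq (maximalIdeal R)
  let c : Fin 3 → Fin d := Fin.castLE hd3
  have hc : Function.Injective c := Fin.castLE_injective hd3
  have : Nontrivial (Fin (l + 1)) := Fin.nontrivial_iff_two_le.mpr (by lia)
  let z : Fin (l + 1) → R := fun i => ((i : ℕ) : R)
  let H : Fin (l + 1) → MvPolynomial (Fin d) R := fun i => rename c (tangentProd z i)
  obtain ⟨f, hf⟩ := hsum (∑ i, eval x (H i) ^ (2 * s)) ⟨l + 1, _, rfl⟩
  obtain ⟨F, hF, hFsum⟩ := exists_isHomogeneous_sum_pow_eq hd.symm (by lia) hx hs0 H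
    (fun i => (isHomogeneous_tangentProd z i).rename_isHomogeneous) f hf.symm
  -- Set the parameters other than the first three to zero.
  have hG := congrArg (killCompl hc) hFsum
  simp only [map_sum, map_pow, H, map_rename, killCompl_rename_app, map_tangentProd] at hG
  have hle := card_le_of_sum_pow_eq_sum_tangentProd_pow hs0 (residue R ∘ z)
    (fun i j hij => Fin.ext (by simpa [z] using hij)) (fun j => killCompl hc (F j))
    (fun j => by simpa using (hF j).killCompl hc) hG
  simp at hle
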